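/- Call a matrix $A\in M_n(\mathbb{C})$ accretive if its real part $\frac12(A+A^*)$ is positive definite. For a matrix $M\in M_n(\mathbb C)$ without eigenvalues in $(-\infty,0]$ let $M^{1/2}$ be its principal square root, that is, the unique $S$ with $S^2=M$ all of whose eigenvalues lie in the open right half-plane, and let $M^{-1/2}=(M^{1/2})^{-1}$. For accretive $A,B\in M_n(\mathbb C)$ their geometric mean is $$A\sharp B=A^{1/2}\left(A^{-1/2}BA^{-1/2}\right)^{1/2}A^{1/2}.$$ Let $A_1,\dots,A_m\in M_n(\mathbb{C})$ be accretive, let $\lambda_1,\dots,\lambda_m\in[0,1]$ with $\sum_{i=1}^m\lambda_i=1$, and let $\mu\ge 0$ be real. Put $\mathbf A=(A_1,\dots,A_m)$, $\boldsymbol\lambda=(\lambda_1,\dots,\lambda_m)$ and $$\mathcal L_\mu(\mathbf A,\boldsymbol\lambda)=\left(\sum_{i=1}^m\lambda_i(A_i+\mu I)\right)\sharp\left(\sum_{i=1}^m\lambda_i(A_i+\mu I)^{-1}\right)^{-1}-\mu I .$$ **Theorem.** The matrix $\mathcal L_\mu(\mathbf A,\boldsymbol\lambda)+\mu I$ is accretive,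 it satisfies the equation $$\sum_{i=1}^m\lambda_i\,X(A_i+\mu I)^{-1}X=\sum_{i=1}^m\lambda_i(A_i+\mu I),$$ and it is the only accretive matrix $X\in M_n(\mathbb C)$ that satisfies it. -/

import Mathlib

open scoped ComplexOrder Matrix

namespace AccretiveMean

/-- The real part `(A + A*) / 2` in the Cartesian decomposition of a complex square matrix. -/
noncomputable def rePart {n : ℕ} (A : Matrix (Fin n) (Fin n) ℂ) : Matrix (Fin n) (Fin n) ℂ :=
  (1 / 2 : ℂ) • (A + Aᴴ)

/-- A complex square matrix is accretive if its real part is positive definite. -/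
def IsAccretive {n : ℕ} (A : Matrix (Fin n) (Fin n) ℂ) : Prop :=
  (rePart A).PosDef

/-- `S` is a principal square root of `A`: it squares to `A` and all its eigenvalues lie in the
open right half-plane. -/
def IsPrincipalSqrt {n : ℕ} (S A : Matrix (Fin n) (Fin n) ℂ) : Prop :=
  S * S = A ∧ ∀ z ∈ spectrum ℂ S, 0 < z.re

/-- There is at most one principal square root. -/
theorem IsPrincipalSqrt.unique {n : ℕ} {S T A : Matrix (Fin n) (Fin n) ℂ}
    (hS : IsPrincipalSqrt S A) (hT : IsPrincipalSqrt T A) : S = T := by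
  have hsyl : SemiconjBy (S - T) (-T) S := by
    have h : S * S = T * T := hS.1.trans hT.1.symm
    change (S - T) * (-T) = S * (S - T)
    rw [sub_mul, mul_sub, h]
    noncomm_ring
  have hpoly : ∀ p : Polynomial ℂ,
      (S - T) * Polynomial.aeval (-T) p = Polynomial.aeval S p * (S - T) := by
    intro p
    induction p using Polynomial.induction_on' with
    | add p q hp hq => simp only [map_add, mul_add, add_mul, hp, hq]
    | monomial k a =>
      have := (hsyl.pow_right k).eq
      simp only [Polynomial.aeval_monomial, ← Algebra.smul_def, mul_smul_comm, smul_mul_assoc,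
        this]
  have h0 : (S - T) * Polynomial.aeval (-T) S.charpoly = 0 := by
    rw [hpoly, Matrix.aeval_self_charpoly, zero_mul]
  have hunit : IsUnit (Polynomial.aeval (-T) S.charpoly) := by
    by_contra hc
    have hz : (0 : ℂ) ∈ spectrum ℂ (Polynomial.aeval (-T) S.charpoly) := by
      rwa [spectrum.zero_mem_iff]
    have hne : Nontrivial (Matrix (Fin n) (Fin n) ℂ) := by
      by_contra hn
      rw [not_nontrivial_iff_subsingleton] at hn
      exact hc (by rw [Subsingleton.elim (Polynomial.aeval (-T) S.charpoly) 1]; exact isUnit_one)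
    rw [spectrum.map_polynomial_aeval_of_nonempty _ _
      (spectrum.nonempty_of_isAlgClosed_of_finiteDimensional ℂ (-T))] at hz
    obtain ⟨w, hw, hw0⟩ := hz
    have h1 : 0 < (-w).re := by
      apply hT.2
      rw [← neg_neg T, ← spectrum.neg_eq]
      simpa using hw
    have h2 : 0 < w.re := hS.2 w (Matrix.mem_spectrum_iff_isRoot_charpoly.mpr hw0)
    rw [Complex.neg_re] at h1
    linarith
  exact sub_eq_zero.mp ((hunit.mul_left_eq_zero).mp h0)

open Classical in
/-- The principal square root `A ^ (1/2)` of a complex square matrix; it exists for each matrix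
without eigenvalues in `(-∞, 0]`, and the value is `0` where there is none. -/
noncomputable def principalSqrt {n : ℕ} (A : Matrix (Fin n) (Fin n) ℂ) :
    Matrix (Fin n) (Fin n) ℂ :=
  if h : ∃ S, IsPrincipalSqrt S A then h.choose else 0

/-- The geometric mean `A^(1/2) (A^(-1/2) B A^(-1/2))^(1/2) A^(1/2)`. -/
noncomputable def geomMean {n : ℕ} (A B : Matrix (Fin n) (Fin n) ℂ) :
    Matrix (Fin n) (Fin n) ℂ :=
  principalSqrt A * principalSqrt ((principalSqrt A)⁻¹ * B * (principalSqrt A)⁻¹) *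
    principalSqrt A

/-- The weighted arithmetic mean. -/
noncomputable def arithMean {n m : ℕ} (A : Fin m → Matrix (Fin n) (Fin n) ℂ) (w : Fin m → ℝ) :
    Matrix (Fin n) (Fin n) ℂ :=
  ∑ i, (w i : ℂ) • A i

/-- The weighted harmonic mean. -/
noncomputable def harmMean {n m : ℕ} (A : Fin m → Matrix (Fin n) (Fin n) ℂ) (w : Fin m → ℝ) :
    Matrix (Fin n) (Fin n) ℂ :=
  (∑ i, (w i : ℂ) • (A i)⁻¹)⁻¹

/-- The shift `A + μ I`. -/
def shift {n : ℕ} (μ : ℝ) (A : Matrix (Fin n) (Fin n) ℂ) : Matrix (Fin n) (Fin n) ℂ :=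
  A + (μ : ℂ) • (1 : Matrix (Fin n) (Fin n) ℂ)

/-- The expression that defines the weighted arithmetic-geometric-harmonic mean for
nonnegative parameters. -/
noncomputable def ahMeanAux {n m : ℕ} (μ : ℝ) (A : Fin m → Matrix (Fin n) (Fin n) ℂ)
    (w : Fin m → ℝ) : Matrix (Fin n) (Fin n) ℂ :=
  geomMean (arithMean (fun i => shift μ (A i)) w) (harmMean (fun i => shift μ (A i)) w) -
    (μ : ℂ) • (1 : Matrix (Fin n) (Fin n) ℂ)

/-- The weighted `A♯H`-mean of parameter `μ`; for `μ < 0` it is the inverse of the mean of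
parameter `-μ` of the inverses. -/
noncomputable def ahMean {n m : ℕ} (μ : ℝ) (A : Fin m → Matrix (Fin n) (Fin n) ℂ)
    (w : Fin m → ℝ) : Matrix (Fin n) (Fin n) ℂ :=
  if 0 ≤ μ then ahMeanAux μ A w else (ahMeanAux (-μ) (fun i => (A i)⁻¹) w)⁻¹

end AccretiveMean

namespace AccretiveMean

open Matrix Filter Topology

variable {n : ℕ}

/-! Put C = ∑ wᵢ(Aᵢ + μ) and D = ∑ wᵢ(Aᵢ + μ)⁻¹. Both are accretive, the equation reads XDX = C, and
the claimed solution is C ♯ D⁻¹.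

Existence (`exists_isAccretive_mul_mul_eq`): DC has no eigenvalue in (-∞, 0], so it has a principal
root Z, and X = D⁻¹Z solves XDX = C. Since X = D⁻¹Z and XZ = C, the form of Z*X + XZ is ⟨Zu, D⁻¹Zu⟩
+ ⟨u, Cu⟩, of positive real part; Lyapunov's theorem makes X accretive.

Uniqueness (`eq_geomMean`): for any accretive solution X and S = C^(1/2), the matrix S⁻¹XS⁻¹ squares
to S⁻¹D⁻¹S⁻¹ and is similar to (DX)⁻¹, whose spectrum lies in the right half-plane. It is thus the
principal root, and X = C ♯ D⁻¹. -/

theorem star_dotProduct_rePart_mulVec (A : Matrix (Fin n) (Fin n) ℂ) (x : Fin n → ℂ) :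
    star x ⬝ᵥ (rePart A *ᵥ x) = ((star x ⬝ᵥ (A *ᵥ x)).re : ℂ) := by
  have h : star x ⬝ᵥ (Aᴴ *ᵥ x) = star (star x ⬝ᵥ (A *ᵥ x)) := by
    rw [dotProduct_mulVec, ← star_mulVec, star_dotProduct]
  rw [rePart, smul_mulVec, dotProduct_smul, add_mulVec, dotProduct_add, h, Complex.re_eq_add_conj,
    smul_eq_mul, starRingEnd_apply]
  ring

theorem isAccretive_iff {A : Matrix (Fin n) (Fin n) ℂ} :
    IsAccretive A ↔ ∀ x, x ≠ 0 → 0 < (star x ⬝ᵥ (A *ᵥ x)).re := by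
  rw [IsAccretive, posDef_iff_dotProduct_mulVec]
  have hH : (rePart A).IsHermitian := by
    simp [rePart, IsHermitian, conjTranspose_smul, add_comm]
  simp [hH, star_dotProduct_rePart_mulVec]

theorem IsAccretive.isUnit {A : Matrix (Fin n) (Fin n) ℂ} (hA : IsAccretive A) : IsUnit A := by
  rw [isUnit_iff_isUnit_det, isUnit_iff_ne_zero]
  intro h
  obtain ⟨v, hv, hAv⟩ := exists_mulVec_eq_zero_iff.mpr h
  simpa [hAv] using isAccretive_iff.mp hA v hv

theorem re_dotProduct_comm (x y : Fin n → ℂ) : (star x ⬝ᵥ y).re = (star y ⬝ᵥ x).re := by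
  rw [← star_star (star x ⬝ᵥ y), ← star_dotProduct_star, star_star, dotProduct_comm]
  simp

/-- With y = A⁻¹x, the numbers ⟨x, A⁻¹x⟩ and ⟨y, Ay⟩ are complex conjugates. -/
theorem IsAccretive.inv {A : Matrix (Fin n) (Fin n) ℂ} (hA : IsAccretive A) : IsAccretive A⁻¹ := by
  rw [isAccretive_iff]
  intro x hx
  have hdet := (isUnit_iff_isUnit_det A).mp hA.isUnit
  have hAx : A *ᵥ (A⁻¹ *ᵥ x) = x := by rw [mulVec_mulVec, mul_nonsing_inv _ hdet, one_mulVec]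
  have hne : A⁻¹ *ᵥ x ≠ 0 := fun h => hx (by rw [← hAx, h, mulVec_zero])
  have := isAccretive_iff.mp hA _ hne
  rwa [hAx, re_dotProduct_comm] at this

theorem IsAccretive.sum {m : ℕ} {A : Fin m → Matrix (Fin n) (Fin n) ℂ}
    (hA : ∀ i, IsAccretive (A i)) {w : Fin m → ℝ} (hw : ∀ i, 0 ≤ w i) (hw1 : ∑ i, w i = 1) :
    IsAccretive (∑ i, (w i : ℂ) • A i) := by
  rw [isAccretive_iff]
  intro x hx
  rw [sum_mulVec, dotProduct_sum, Complex.re_sum]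
  have hterm : ∀ i, (star x ⬝ᵥ (((w i : ℂ) • A i) *ᵥ x)).re
      = w i * (star x ⬝ᵥ (A i *ᵥ x)).re := fun i => by
    rw [smul_mulVec, dotProduct_smul, smul_eq_mul, Complex.re_ofReal_mul]
  obtain ⟨j, hj⟩ : ∃ j, w j ≠ 0 := by
    by_contra! h
    simp [h] at hw1
  refine Finset.sum_pos' (fun i _ => ?_) ⟨j, Finset.mem_univ j, ?_⟩ <;> rw [hterm]
  · exact mul_nonneg (hw i) (isAccretive_iff.mp (hA i) x hx).le
  · exact mul_pos ((hw j).lt_of_ne' hj) (isAccretive_iff.mp (hA j) x hx)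

theorem IsAccretive.shift {A : Matrix (Fin n) (Fin n) ℂ} (hA : IsAccretive A) {μ : ℝ}
    (hμ : 0 ≤ μ) : IsAccretive (shift μ A) := by
  rw [isAccretive_iff]
  intro x hx
  rw [AccretiveMean.shift, add_mulVec, dotProduct_add, smul_mulVec, one_mulVec, dotProduct_smul,
    smul_eq_mul, Complex.add_re, Complex.re_ofReal_mul]
  have h := (Complex.nonneg_iff.mp (dotProduct_star_self_nonneg x)).1
  exact add_pos_of_pos_of_nonneg (isAccretive_iff.mp hA x hx) (mul_nonneg hμ h)

/-! ### Eigenvectors and principal square roots -/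

theorem exists_mulVec_eq_smul {A : Matrix (Fin n) (Fin n) ℂ} {z : ℂ} (hz : z ∈ spectrum ℂ A) :
    ∃ v, v ≠ 0 ∧ A *ᵥ v = z • v := by
  rw [spectrum.mem_iff, isUnit_iff_isUnit_det, isUnit_iff_ne_zero, not_not] at hz
  obtain ⟨v, hv, h⟩ := exists_mulVec_eq_zero_iff.mpr hz
  refine ⟨v, hv, ?_⟩
  rw [sub_mulVec, Algebra.algebraMap_eq_smul_one, smul_mulVec, one_mulVec, sub_eq_zero] at h
  exact h.symm

theorem mem_spectrum_of_mulVec_eq_smul {A : Matrix (Fin n) (Fin n) ℂ} {z : ℂ} {v : Fin n → ℂ}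
    (hv : v ≠ 0) (h : A *ᵥ v = z • v) : z ∈ spectrum ℂ A := by
  rw [spectrum.mem_iff, isUnit_iff_isUnit_det, isUnit_iff_ne_zero, not_not]
  refine exists_mulVec_eq_zero_iff.mp ⟨v, hv, ?_⟩
  rw [sub_mulVec, Algebra.algebraMap_eq_smul_one, smul_mulVec, one_mulVec, h, sub_self]

open Polynomial in
/-- A complex matrix without eigenvalues in `(-∞, 0]` has a principal square root. -/
theorem exists_isPrincipalSqrt {A : Matrix (Fin n) (Fin n) ℂ}
    (hA : ∀ z ∈ spectrum ℂ A, z ∈ Complex.slitPlane) : ∃ S, IsPrincipalSqrt S A := by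
  rcases subsingleton_or_nontrivial (Matrix (Fin n) (Fin n) ℂ) with hn | hn
  · exact ⟨A, Subsingleton.elim _ _, fun z hz => absurd (isUnit_of_subsingleton _) hz⟩
  set f := A.charpoly
  have hf : f ≠ 0 := A.charpoly_monic.ne_zero
  have hroot : ∀ {z : ℂ}, f.IsRoot z ↔ z ∈ spectrum ℂ A :=
    fun {z} => mem_spectrum_iff_isRoot_charpoly.symm
  let s : ℂ → ℂ := fun z => z ^ (1 / 2 : ℂ)
  have hs : ∀ z, s z * s z = z := fun z => by
    rw [← sq]
    simp [s]
  have hsre : ∀ z ∈ Complex.slitPlane, 0 < (s z).re := fun z hz => by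
    have hz0 : z ≠ 0 := Complex.slitPlane_ne_zero hz
    have harg := Complex.mem_slitPlane_iff_arg.mp hz
    have h1 := Complex.neg_pi_lt_arg z
    have h2 := (Complex.arg_le_pi z).lt_of_ne harg.1
    have him : (Complex.log z * (1 / 2)).im = z.arg / 2 := by
      simp [Complex.mul_im, Complex.log_im]
      ring
    simp only [s]
    rw [Complex.cpow_def_of_ne_zero hz0, Complex.exp_re, him]
    exact mul_pos (Real.exp_pos _) (Real.cos_pos_of_mem_Ioo ⟨by linarith, by linarith⟩)
  -- `g` takes the right values at the eigenvalues but ignores multiplicities, so g² - X is only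
  -- nilpotent modulo `f`. Newton's iteration in ℂ[X]/(f) corrects it to an exact root `q` of X.
  let g : ℂ[X] := Lagrange.interpolate f.roots.toFinset id s
  have hg : ∀ z, f.IsRoot z → g.eval z = s z := fun z hz =>
    Lagrange.eval_interpolate_at_node s Function.injective_id.injOn
      (by simpa [hf] using hz : z ∈ f.roots.toFinset)
  have hdvd : ∀ p : ℂ[X], (∀ z, f.IsRoot z → p.IsRoot z) → ∃ k, f ∣ p ^ k := by
    intro p hp
    -- `f` is a product of this many linear factors, each dividing `p`.
    refine ⟨f.roots.card, ?_⟩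
    conv_lhs => rw [(IsAlgClosed.splits f).eq_prod_roots_of_monic A.charpoly_monic]
    rw [← Multiset.card_map (fun a => X - C a) f.roots, ← Multiset.prod_replicate,
      ← Multiset.map_const', Multiset.map_map]
    refine Multiset.prod_dvd_prod_of_dvd _ _ fun a ha => ?_
    exact dvd_iff_isRoot.mpr (hp a (isRoot_of_mem_roots ha))
  have hcop : IsCoprime f (2 * g) := by
    refine isCoprime_of_irreducible_dvd (fun h => hf h.1) fun p hp hpf hpg => ?_
    obtain ⟨z, hz⟩ := IsAlgClosed.exists_root p hp.degree_pos.ne'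
    have h1 := hz.dvd hpf
    have h2 := hz.dvd hpg
    have h3 := hsre z (hA z (hroot.mp h1))
    rw [IsRoot, eval_mul, hg z h1] at h2
    have : s z = 0 := by simpa using h2
    simp [this] at h3
  let P : (AdjoinRoot f)[X] := X ^ 2 - C (AdjoinRoot.root f)
  have hnil : IsNilpotent (aeval (AdjoinRoot.mk f g) P) := by
    obtain ⟨k, hk⟩ := hdvd (g ^ 2 - X) fun z hz => by
      simp [IsRoot, hg z hz, sq, hs]
    refine ⟨k, ?_⟩
    rw [← AdjoinRoot.mk_eq_zero] at hk
    simpa [P] using hk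
  have hunit : IsUnit (aeval (AdjoinRoot.mk f g) (derivative P)) := by
    obtain ⟨a, b, hab⟩ := hcop
    have h := congrArg (AdjoinRoot.mk f) hab
    simp only [map_add, map_mul, AdjoinRoot.mk_self, mul_zero, zero_add, map_one] at h
    refine IsUnit.of_mul_eq_one (AdjoinRoot.mk f b) ?_
    rw [mul_comm]
    simpa [P, one_add_one_eq_two, map_ofNat (AdjoinRoot.mk f) 2] using h
  obtain ⟨r, ⟨hr, hr0⟩, -⟩ := existsUnique_nilpotent_sub_and_aeval_eq_zero hnil hunit
  obtain ⟨q, rfl⟩ := AdjoinRoot.mk_surjective r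
  have hq : f ∣ q ^ 2 - X := by
    rw [← AdjoinRoot.mk_eq_zero]
    simpa [P] using hr0
  obtain ⟨k, hk⟩ := hr
  have hqg : f ∣ (g - q) ^ k := by
    rw [← AdjoinRoot.mk_eq_zero]
    simpa using hk
  refine ⟨aeval A q, ?_, ?_⟩
  · obtain ⟨c, hc⟩ := hq
    have h := congrArg (aeval A) hc
    rw [map_mul, aeval_self_charpoly, zero_mul, map_sub, map_pow, aeval_X, sub_eq_zero, sq] at h
    exact h
  · rw [spectrum.map_polynomial_aeval_of_nonempty _ _
      (spectrum.nonempty_of_isAlgClosed_of_finiteDimensional ℂ A)]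
    rintro _ ⟨z, hz, rfl⟩
    -- A nilpotent correction does not change values at the eigenvalues.
    have h1 := (hroot.mpr hz).dvd hqg
    rw [IsRoot, eval_pow, eval_sub, hg z (hroot.mpr hz)] at h1
    have h2 : q.eval z = s z := (sub_eq_zero.mp (eq_zero_of_pow_eq_zero h1)).symm
    show 0 < (q.eval z).re
    rw [h2]
    exact hsre z (hA z hz)

/-! ### Lyapunov's theorem via the Cayley transform -/

section PowerLimit

open scoped Matrix.Norms.Operator NNReal ENNReal

/-- By Gelfand's formula, ‖Wᵏ‖ ≤ rᵏ eventually, for some r between the spectral radius and 1. -/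
theorem tendsto_pow_mulVec {W : Matrix (Fin n) (Fin n) ℂ} (hW : ∀ z ∈ spectrum ℂ W, ‖z‖ < 1)
    (x : Fin n → ℂ) : Tendsto (fun k : ℕ => W ^ k *ᵥ x) atTop (𝓝 0) := by
  rcases isEmpty_or_nonempty (Fin n) with hn | hn
  · exact tendsto_const_nhds.congr fun k => Subsingleton.elim _ _
  have hrad : spectralRadius ℂ W < (1 : ℝ≥0) :=
    spectrum.spectralRadius_lt_of_forall_lt W fun z hz => by
      simpa [← NNReal.coe_lt_coe] using hW z hz
  obtain ⟨r, hr, hr1⟩ := ENNReal.lt_iff_exists_nnreal_btwn.mp hrad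
  have hlim := spectrum.pow_nnnorm_pow_one_div_tendsto_nhds_spectralRadius W
  have hle : ∀ᶠ k : ℕ in atTop, ‖W ^ k‖ ≤ (r : ℝ) ^ k := by
    filter_upwards [hlim.eventually_lt_const hr, eventually_gt_atTop 0] with k hk hk0
    rw [one_div, ENNReal.rpow_inv_lt_iff (by exact_mod_cast hk0), ENNReal.rpow_natCast] at hk
    exact_mod_cast hk.le
  have hr1' : (r : ℝ) < 1 := by exact_mod_cast hr1
  have hpow : Tendsto (fun k : ℕ => W ^ k) atTop (𝓝 0) :=
    squeeze_zero_norm' hle (tendsto_pow_atTop_nhds_zero_of_lt_one r.coe_nonneg hr1')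
  have hcont : Continuous fun M : Matrix (Fin n) (Fin n) ℂ => M *ᵥ x := by fun_prop
  simpa [Function.comp_def] using (hcont.tendsto 0).comp hpow

end PowerLimit

/-- An eigenvalue z of the transform comes from the eigenvalue (1 + z)/(1 - z) of `Z`, whose real
part has the sign of 1 - |z|². -/
theorem norm_lt_one_of_mem_spectrum_cayley {Z : Matrix (Fin n) (Fin n) ℂ}
    (hZ : ∀ z ∈ spectrum ℂ Z, 0 < z.re) (hU : (Z + 1) * (Z + 1)⁻¹ = 1) :
    ∀ z ∈ spectrum ℂ ((Z - 1) * (Z + 1)⁻¹), ‖z‖ < 1 := by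
  intro z hz
  obtain ⟨v, hv, h⟩ := exists_mulVec_eq_smul hz
  set u := (Z + 1)⁻¹ *ᵥ v
  have hu : (Z + 1) *ᵥ u = v := by rw [mulVec_mulVec, hU, one_mulVec]
  have hu0 : u ≠ 0 := fun h0 => hv (by rw [← hu, h0, mulVec_zero])
  rw [← mulVec_mulVec] at h
  change (Z - 1) *ᵥ u = _ at h
  rw [← hu, sub_mulVec, add_mulVec, one_mulVec] at h
  have h1 : (1 - z) • (Z *ᵥ u) = (1 + z) • u := by
    rw [smul_add, sub_eq_iff_eq_add] at h
    rw [sub_smul, one_smul, sub_eq_iff_eq_add]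
    exact h.trans (by module)
  have hz1 : 1 - z ≠ 0 := by
    intro h0
    rw [h0, zero_smul, ← sub_eq_zero.mp h0] at h1
    have := smul_eq_zero.mp h1.symm
    norm_num [hu0] at this
  have h2 : Z *ᵥ u = ((1 + z) / (1 - z)) • u := by
    rw [div_eq_inv_mul, mul_smul, ← h1, inv_smul_smul₀ hz1]
  have h3 := hZ _ (mem_spectrum_of_mulVec_eq_smul hu0 h2)
  have hpos : 0 < Complex.normSq (1 - z) := Complex.normSq_pos.mpr hz1
  rw [Complex.div_re, ← add_div, div_pos_iff_of_pos_right hpos] at h3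
  rw [← abs_of_nonneg (norm_nonneg z), ← abs_one, ← sq_lt_sq, ← Complex.normSq_eq_norm_sq,
    Complex.normSq_apply]
  simp at h3
  linarith

/-- Lyapunov's theorem in the form needed for accretive matrices. -/
theorem isAccretive_of_lyapunov {X Z : Matrix (Fin n) (Fin n) ℂ}
    (hZ : ∀ z ∈ spectrum ℂ Z, 0 < z.re)
    (hpos : ∀ u, u ≠ 0 → 0 < (star (Z *ᵥ u) ⬝ᵥ (X *ᵥ u)).re + (star u ⬝ᵥ (X *ᵥ (Z *ᵥ u))).re) :
    IsAccretive X := by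
  have hdet : IsUnit (Z + 1) := by
    rw [isUnit_iff_isUnit_det, isUnit_iff_ne_zero]
    intro h0
    obtain ⟨v, hv, h⟩ := exists_mulVec_eq_zero_iff.mpr h0
    have h1 : Z *ᵥ v = (-1 : ℂ) • v := by
      rw [add_mulVec, one_mulVec] at h
      rw [neg_one_smul]
      exact eq_neg_of_add_eq_zero_left h
    have := hZ _ (mem_spectrum_of_mulVec_eq_smul hv h1)
    norm_num at this
  have hU : (Z + 1) * (Z + 1)⁻¹ = 1 := mul_nonsing_inv _ ((isUnit_iff_isUnit_det _).mp hdet)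
  set W := (Z - 1) * (Z + 1)⁻¹ with hWdef
  -- For x = (Z + 1)u, Wx = (Z - 1)u, the two sides differ by twice the quantity in `hpos`.
  have hlt : ∀ x, x ≠ 0 → (star (W *ᵥ x) ⬝ᵥ (X *ᵥ (W *ᵥ x))).re < (star x ⬝ᵥ (X *ᵥ x)).re := by
    intro x hx
    obtain ⟨u, hudef⟩ : ∃ u, u = (Z + 1)⁻¹ *ᵥ x := ⟨_, rfl⟩
    have hu : x = Z *ᵥ u + u := by
      nth_rewrite 1 [← one_mulVec x, ← hU, ← mulVec_mulVec, add_mulVec, one_mulVec]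
      rw [← hudef]
    have hWx : W *ᵥ x = Z *ᵥ u - u := by
      rw [hWdef, ← mulVec_mulVec, ← hudef, sub_mulVec, one_mulVec]
    have hu0 : u ≠ 0 := fun h0 => hx (by rw [hu, h0, mulVec_zero, add_zero])
    have := hpos u hu0
    rw [hWx, hu]
    simp only [mulVec_add, mulVec_sub, star_add, star_sub, add_dotProduct, sub_dotProduct,
      dotProduct_add, dotProduct_sub, Complex.add_re, Complex.sub_re]
    linarith
  have hle : ∀ x, (star (W *ᵥ x) ⬝ᵥ (X *ᵥ (W *ᵥ x))).re ≤ (star x ⬝ᵥ (X *ᵥ x)).re := by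
    intro x
    rcases eq_or_ne x 0 with rfl | hx
    · simp
    · exact (hlt x hx).le
  have hnonneg : ∀ x, 0 ≤ (star x ⬝ᵥ (X *ᵥ x)).re := by
    intro x
    -- The form decreases along Wᵏx → 0, so its value at x is at least its limit 0.
    have hanti : Antitone fun k : ℕ => (star (W ^ k *ᵥ x) ⬝ᵥ (X *ᵥ (W ^ k *ᵥ x))).re := by
      refine antitone_nat_of_succ_le fun k => ?_
      rw [pow_succ', ← mulVec_mulVec]
      exact hle _
    have hcont : Continuous fun y : Fin n → ℂ => (star y ⬝ᵥ (X *ᵥ y)).re := by fun_prop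
    have hlim := (hcont.tendsto 0).comp
      (tendsto_pow_mulVec (norm_lt_one_of_mem_spectrum_cayley hZ hU) x)
    rw [star_zero, zero_dotProduct, Complex.zero_re] at hlim
    simpa using hanti.le_of_tendsto hlim 0
  exact isAccretive_iff.mpr fun x hx => (hnonneg _).trans_lt (hlt x hx)

/-! ### The Riccati equation and the geometric mean -/

/-- A product of two accretive matrices has no eigenvalues in `(-∞, 0]`. -/
theorem IsAccretive.mem_slitPlane_of_mem_spectrum_mul {C D : Matrix (Fin n) (Fin n) ℂ}
    (hC : IsAccretive C) (hD : IsAccretive D) : ∀ z ∈ spectrum ℂ (D * C), z ∈ Complex.slitPlane := by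
  intro z hz
  obtain ⟨v, hv, h⟩ := exists_mulVec_eq_smul hz
  by_contra hz0
  rw [Complex.mem_slitPlane_iff, not_or, not_lt, not_not] at hz0
  rw [← mulVec_mulVec] at h
  have h1 := isAccretive_iff.mp hC v hv
  have hu : C *ᵥ v ≠ 0 := fun h0 => by simp [h0] at h1
  have h2 := isAccretive_iff.mp hD _ hu
  rw [h, dotProduct_smul, smul_eq_mul, Complex.mul_re, hz0.2, zero_mul, sub_zero,
    re_dotProduct_comm] at h2
  nlinarith [hz0.1]

/-- Let DXv = zv and a = ⟨v, Xv⟩. Then za = ⟨v, Cv⟩ and zā = ⟨Xv, DXv⟩ have positive real parts,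
whose sum is 2 Re z Re a, and Re a > 0. -/
theorem re_pos_of_mem_spectrum_mul {C D X : Matrix (Fin n) (Fin n) ℂ}
    (hC : IsAccretive C) (hD : IsAccretive D) (hX : IsAccretive X) (h : X * D * X = C) :
    ∀ z ∈ spectrum ℂ (D * X), 0 < z.re := by
  intro z hz
  obtain ⟨v, hv, hzv⟩ := exists_mulVec_eq_smul hz
  have h1 := isAccretive_iff.mp hX v hv
  have hu : X *ᵥ v ≠ 0 := fun h0 => by simp [h0] at h1
  have h2 := isAccretive_iff.mp hD _ hu
  have h3 := isAccretive_iff.mp hC v hv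
  rw [← h, mul_assoc, ← mulVec_mulVec, hzv, mulVec_smul, dotProduct_smul] at h3
  rw [mulVec_mulVec, hzv, dotProduct_smul] at h2
  have h4 : star (X *ᵥ v) ⬝ᵥ v = star (star v ⬝ᵥ (X *ᵥ v)) := by
    rw [← star_dotProduct_star, star_star, dotProduct_comm]
  rw [h4] at h2
  simp only [smul_eq_mul, Complex.mul_re, Complex.star_def, Complex.conj_re, Complex.conj_im]
    at h2 h3
  nlinarith

/-- The Riccati equation `X D X = C` with accretive coefficients has an accretive solution. -/
theorem exists_isAccretive_mul_mul_eq {C D : Matrix (Fin n) (Fin n) ℂ}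
    (hC : IsAccretive C) (hD : IsAccretive D) : ∃ X, IsAccretive X ∧ X * D * X = C := by
  obtain ⟨Z, hZ, hZs⟩ := exists_isPrincipalSqrt (hC.mem_slitPlane_of_mem_spectrum_mul hD)
  have hdet := (isUnit_iff_isUnit_det D).mp hD.isUnit
  have hDX : D * (D⁻¹ * Z) = Z := mul_nonsing_inv_cancel_left _ _ hdet
  have hXZ : D⁻¹ * Z * Z = C := by rw [mul_assoc, hZ, nonsing_inv_mul_cancel_left _ _ hdet]
  refine ⟨D⁻¹ * Z, isAccretive_of_lyapunov hZs fun u hu => ?_, by rw [mul_assoc, hDX, hXZ]⟩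
  rw [mulVec_mulVec u, hXZ, ← mulVec_mulVec]
  refine add_pos_of_nonneg_of_pos ?_ (isAccretive_iff.mp hC u hu)
  rcases eq_or_ne (Z *ᵥ u) 0 with h0 | h0
  · simp [h0]
  · exact (isAccretive_iff.mp hD.inv _ h0).le

theorem isPrincipalSqrt_principalSqrt {A : Matrix (Fin n) (Fin n) ℂ}
    (h : ∃ S, IsPrincipalSqrt S A) : IsPrincipalSqrt (principalSqrt A) A := by
  rw [principalSqrt, dif_pos h]
  exact h.choose_spec

theorem IsPrincipalSqrt.principalSqrt_eq {S A : Matrix (Fin n) (Fin n) ℂ}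
    (h : IsPrincipalSqrt S A) : principalSqrt A = S :=
  (isPrincipalSqrt_principalSqrt ⟨S, h⟩).unique h

theorem isAccretive_one : IsAccretive (1 : Matrix (Fin n) (Fin n) ℂ) := by
  have h : rePart (1 : Matrix (Fin n) (Fin n) ℂ) = 1 := by
    rw [rePart, conjTranspose_one, ← two_smul ℂ, smul_smul]
    norm_num
  rw [IsAccretive, h]
  exact PosDef.one

/-- An accretive solution of `X D X = C` with accretive coefficients is the geometric mean of `C`
and `D⁻¹`. -/
theorem eq_geomMean {C D X : Matrix (Fin n) (Fin n) ℂ}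
    (hC : IsAccretive C) (hD : IsAccretive D) (hX : IsAccretive X) (h : X * D * X = C) :
    X = geomMean C D⁻¹ := by
  have hS : IsPrincipalSqrt (principalSqrt C) C := isPrincipalSqrt_principalSqrt
    (exists_isPrincipalSqrt (by simpa using hC.mem_slitPlane_of_mem_spectrum_mul isAccretive_one))
  rw [geomMean]
  set S := principalSqrt C
  have hSu : IsUnit S := isUnit_of_mul_isUnit_left (hS.1 ▸ hC.isUnit)
  have hSdet := (isUnit_iff_isUnit_det S).mp hSu
  have hXdet := (isUnit_iff_isUnit_det X).mp hX.isUnit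
  have hDdet := (isUnit_iff_isUnit_det D).mp hD.isUnit
  have hCinv : S⁻¹ * S⁻¹ = X⁻¹ * D⁻¹ * X⁻¹ := by
    rw [← Matrix.mul_inv_rev, hS.1, ← h, Matrix.mul_inv_rev, Matrix.mul_inv_rev, mul_assoc]
  have hT : IsPrincipalSqrt (S⁻¹ * X * S⁻¹) (S⁻¹ * D⁻¹ * S⁻¹) := by
    constructor
    · calc S⁻¹ * X * S⁻¹ * (S⁻¹ * X * S⁻¹) = S⁻¹ * X * (S⁻¹ * S⁻¹) * X * S⁻¹ := by
            simp only [mul_assoc]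
        _ = S⁻¹ * (X * X⁻¹) * D⁻¹ * (X⁻¹ * X) * S⁻¹ := by rw [hCinv]; simp only [mul_assoc]
        _ = S⁻¹ * D⁻¹ * S⁻¹ := by
            rw [mul_nonsing_inv _ hXdet, nonsing_inv_mul _ hXdet, mul_one, mul_one]
    · intro z hz
      obtain ⟨v, hv, hzv⟩ := exists_mulVec_eq_smul hz
      have hSS : S * S⁻¹ = 1 := mul_nonsing_inv _ hSdet
      have hu0 : S⁻¹ *ᵥ v ≠ 0 := fun h0 => hv (by
        rw [← one_mulVec v, ← hSS, ← mulVec_mulVec, h0, mulVec_zero])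
      -- Conjugation by S turns S⁻¹XS⁻¹ into S⁻²X = X⁻¹D⁻¹ = (DX)⁻¹; inversion keeps the sign of the
      -- real part of an eigenvalue.
      have h1 : (X⁻¹ * D⁻¹) *ᵥ (S⁻¹ *ᵥ v) = z • (S⁻¹ *ᵥ v) := by
        rw [← mulVec_smul, ← hzv, mulVec_mulVec, mulVec_mulVec]
        congr 1
        rw [← mul_assoc, ← mul_assoc, hCinv, mul_assoc (X⁻¹ * D⁻¹), nonsing_inv_mul _ hXdet,
          mul_one]
      have h2 : S⁻¹ *ᵥ v = z • ((D * X) *ᵥ (S⁻¹ *ᵥ v)) := by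
        rw [← mulVec_smul, ← h1, mulVec_mulVec, ← Matrix.mul_inv_rev, mul_nonsing_inv, one_mulVec]
        rw [det_mul]
        exact hDdet.mul hXdet
      have hz0 : z ≠ 0 := fun h0 => hu0 (by rw [h2, h0, zero_smul])
      have h3 : (D * X) *ᵥ (S⁻¹ *ᵥ v) = z⁻¹ • (S⁻¹ *ᵥ v) := by
        nth_rewrite 2 [h2]
        rw [inv_smul_smul₀ hz0]
      have h4 := re_pos_of_mem_spectrum_mul hC hD hX h _ (mem_spectrum_of_mulVec_eq_smul hu0 h3)
      rw [Complex.inv_re, div_pos_iff_of_pos_right (Complex.normSq_pos.mpr hz0)] at h4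
      exact h4
  rw [hT.principalSqrt_eq, mul_assoc S⁻¹, mul_nonsing_inv_cancel_left _ _ hSdet,
    nonsing_inv_mul_cancel_right _ _ hSdet]

/-- The solution found by Lyapunov's theorem must be the geometric mean, which inherits its
properties. -/
theorem isAccretive_geomMean {C D : Matrix (Fin n) (Fin n) ℂ}
    (hC : IsAccretive C) (hD : IsAccretive D) : IsAccretive (geomMean C D⁻¹) := by
  obtain ⟨X, hX, h⟩ := exists_isAccretive_mul_mul_eq hC hD
  exact eq_geomMean hC hD hX h ▸ hX

theorem geomMean_mul_mul_geomMean {C D : Matrix (Fin n) (Fin n) ℂ}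
    (hC : IsAccretive C) (hD : IsAccretive D) : geomMean C D⁻¹ * D * geomMean C D⁻¹ = C := by
  obtain ⟨X, hX, h⟩ := exists_isAccretive_mul_mul_eq hC hD
  exact eq_geomMean hC hD hX h ▸ h

end AccretiveMean

theorem mainTheorem3 {n m : ℕ} (A : Fin m → Matrix (Fin n) (Fin n) ℂ)
    (hA : ∀ i, AccretiveMean.IsAccretive (A i)) (w : Fin m → ℝ)
    (hw : ∀ i, w i ∈ Set.Icc (0 : ℝ) 1) (hw1 : ∑ i, w i = 1) (μ : ℝ) (hμ : 0 ≤ μ) :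
    AccretiveMean.IsAccretive
        (AccretiveMean.ahMean μ A w + (μ : ℂ) • (1 : Matrix (Fin n) (Fin n) ℂ)) ∧
      (∑ i, (w i : ℂ) •
          ((AccretiveMean.ahMean μ A w + (μ : ℂ) • (1 : Matrix (Fin n) (Fin n) ℂ)) *
            (A i + (μ : ℂ) • (1 : Matrix (Fin n) (Fin n) ℂ))⁻¹ *
            (AccretiveMean.ahMean μ A w + (μ : ℂ) • (1 : Matrix (Fin n) (Fin n) ℂ))) =
        ∑ i, (w i : ℂ) • (A i + (μ : ℂ) • (1 : Matrix (Fin n) (Fin n) ℂ))) ∧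
      ∀ X : Matrix (Fin n) (Fin n) ℂ, AccretiveMean.IsAccretive X →
        ∑ i, (w i : ℂ) • (X * (A i + (μ : ℂ) • (1 : Matrix (Fin n) (Fin n) ℂ))⁻¹ * X) =
          ∑ i, (w i : ℂ) • (A i + (μ : ℂ) • (1 : Matrix (Fin n) (Fin n) ℂ)) →
        X = AccretiveMean.ahMean μ A w + (μ : ℂ) • (1 : Matrix (Fin n) (Fin n) ℂ) := by
  have hB : ∀ i, AccretiveMean.IsAccretive (AccretiveMean.shift μ (A i)) :=
    fun i => (hA i).shift hμ
  have hw0 : ∀ i, 0 ≤ w i := fun i => (hw i).1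
  have hC := AccretiveMean.IsAccretive.sum hB hw0 hw1
  have hD := AccretiveMean.IsAccretive.sum (fun i => (hB i).inv) hw0 hw1
  have hmean : AccretiveMean.ahMean μ A w + (μ : ℂ) • (1 : Matrix (Fin n) (Fin n) ℂ) =
      AccretiveMean.geomMean (∑ i, (w i : ℂ) • AccretiveMean.shift μ (A i))
        (∑ i, (w i : ℂ) • (AccretiveMean.shift μ (A i))⁻¹)⁻¹ := by
    rw [AccretiveMean.ahMean, if_pos hμ, AccretiveMean.ahMeanAux, sub_add_cancel]
    rfl
  have hsum : ∀ X : Matrix (Fin n) (Fin n) ℂ,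
      ∑ i, (w i : ℂ) • (X * (A i + (μ : ℂ) • (1 : Matrix (Fin n) (Fin n) ℂ))⁻¹ * X) =
        X * (∑ i, (w i : ℂ) • (AccretiveMean.shift μ (A i))⁻¹) * X := by
    intro X
    rw [Finset.mul_sum, Finset.sum_mul]
    simp only [mul_smul_comm, smul_mul_assoc, AccretiveMean.shift]
  simp only [hsum, hmean]
  exact ⟨AccretiveMean.isAccretive_geomMean hC hD,
    AccretiveMean.geomMean_mul_mul_geomMean hC hD,
    fun X hX h => AccretiveMean.eq_geomMean hC hD hX h⟩
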